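/- Let $\Bbbk$ be a field, $n\ge 0$, $S=\Bbbk[x_1,\dots,x_n]$, $\mathfrak m=(x_1,\dots,x_n)$, let $J\subseteq I$ be monomial ideals of $S$ and $M=I/J$, and let $i\ge 0$ be an integer. *Notation.* For $\mathbf a\in\mathbb Z^n$ let $G_{\mathbf a}=\{v\in[n] : a_v<0\}$. For a monomial ideal $K$, the degree complex $\Delta_{\mathbf a}(K)$ is the simplicial complex of all $E\subseteq[n]$ such that $E\cap G_{\mathbf a}=\varnothing$ and, for every minimal monomial generator $x^{\mathbf c}$ of $K$, there is $v\notin E\cup G_{\mathbf a}$ with $c_v>a_v$ (it may be empty, or consist of $\varnothing$ only). For simplicial complexes $\Gamma\subseteq\Delta$ on $[n]$, $\widetilde H^{j}(\Delta,\Gamma)$ is the reduced relative simplicial cohomology with coefficients in $\Bbbk$: the cohomology of the complex of $\Bbbk$-valued functions on the faces in $\Delta\setminus\Gamma$, where a face with $j+1$ elements (including $\varnothing$, for $j=-1$) has degree $j$, with the coboundary $(\delta\varphi)(E)=\sum_{v\in E}(-1)^{\#\{u\in E:\,u<v\}}\varphi(E\setminus\{v\})$, where $\varphi$ is extended by $0$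 to subsets that are not in $\Delta\setminus\Gamma$. Local cohomology $H^i_{\mathfrak m}(M)$ is the $i$-th cohomology of the Čech complex $\bigoplus_{|F|=i}M_{x_F}$ on $x_1,\dots,x_n$, where $x_F=\prod_{v\in F}x_v$, with differential $(dz)_F=\sum_{v\in F}(-1)^{\#\{u\in F:\,u<v\}}z_{F\setminus\{v\}}$; it carries the induced $\mathbb Z^n$-grading, that is, $H^i_{\mathfrak m}(M)_{\mathbf a}$ consists of the classes of the cocycles $(z_F)_{|F|=i}$ with all $z_F\in(M_{x_F})_{\mathbf a}$. *Hochster–Takayama isomorphism.* A $\Bbbk$-linear isomorphism $$\Theta_{\mathbf a}: H^i_{\mathfrak m}(M)_{\mathbf a}\longrightarrow \widetilde H^{\,i-|G_{\mathbf a}|-1}\big(\Delta_{\mathbf a}(J),\Delta_{\mathbf a}(I)\big)$$ is called the relative Hochster–Takayama isomorphism if it sends the class of every cocycle $(z_F)$ that is homogeneous of degree $\mathbf a$ to the class of a relative cocycle $\varphi$ such that $$z_{G_{\mathbf a}\cup E}=(-1)^{\#\{(g,e)\in G_{\mathbf a}\times E:\ g<e\}}\,\varphi(E)\,[x^{\mathbf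 a}]$$ for all $E\in\Delta_{\mathbf a}(J)\setminus\Delta_{\mathbf a}(I)$ with $|G_{\mathbf a}\cup E|=i$, where $[x^{\mathbf a}]\in M_{x_{G_{\mathbf a}\cup E}}$ is the class of the Laurent monomial $x^{\mathbf a}$. (There is at most one such isomorphism.) **Theorem.** Let $\mathbf a\in\mathbb Z^n$ and $\mathbf b\in\mathbb N^n$ with $G_{\mathbf a+\mathbf b}=G_{\mathbf a}$. Then $\Delta_{\mathbf a+\mathbf b}(J)\subseteq\Delta_{\mathbf a}(J)$ and $\Delta_{\mathbf a+\mathbf b}(I)\subseteq\Delta_{\mathbf a}(I)$, the relative Hochster–Takayama isomorphisms $\Theta_{\mathbf a}$ and $\Theta_{\mathbf a+\mathbf b}$ exist, and the diagram $$\begin{array}{ccc} H^i_{\mathfrak m}(M)_{\mathbf a} & \xrightarrow{\ \cdot x^{\mathbf b}\ } & H^i_{\mathfrak m}(M)_{\mathbf a+\mathbf b}\\ {\scriptstyle\Theta_{\mathbf a}}\downarrow\ \ & & \ \ \downarrow{\scriptstyle\Theta_{\mathbf a+\mathbf b}}\\ \widetilde H^{\,i-|G_{\mathbf a}|-1}\big(\Delta_{\mathbf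 a}(J),\Delta_{\mathbf a}(I)\big) & \xrightarrow{\ \iota^*\ } & \widetilde H^{\,i-|G_{\mathbf a}|-1}\big(\Delta_{\mathbf a+\mathbf b}(J),\Delta_{\mathbf a+\mathbf b}(I)\big) \end{array}$$ commutes, where $\iota^*$ is the restriction of cochains induced by the two inclusions. In particular, the map $\cdot x^{\mathbf b}: H^i_{\mathfrak m}(M)_{\mathbf a}\to H^i_{\mathfrak m}(M)_{\mathbf a+\mathbf b}$ is zero if and only if $\iota^*$ is zero. -/

import Mathlib

noncomputable section

namespace RelativeTakayama

open MvPolynomial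

/-! ### Signs -/

/-- The number of elements of `F` that are smaller than `v`. -/
def position {n : ℕ} (F : Finset (Fin n)) (v : Fin n) : ℕ :=
  (F.filter (fun u => u < v)).card

/-- The number of pairs `(g, e)` with `g ∈ G`, `e ∈ E` and `g < e`. -/
def crossings {n : ℕ} (G E : Finset (Fin n)) : ℕ :=
  ∑ e ∈ E, position G e

/-! ### Relative simplicial cohomology

A simplicial complex on `[n]` is a family of subsets of `[n]` closed under passing to subsets. It
may be empty, and it may consist of the empty face only. -/

/-- A simplicial complex on `[n]`. -/
abbrev Complex (n : ℕ) := LowerSet (Finset (Fin n))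

/-- `E` is a face of the relative complex `(Δ, Γ)`. -/
def IsRelFace {n : ℕ} (Δ Γ : Complex n) (E : Finset (Fin n)) : Prop :=
  E ∈ Δ ∧ E ∉ Γ

/-- The relative cochains of degree `j`: the `k`-valued functions on the faces of `(Δ, Γ)` of
dimension `j`, that is, with `j + 1` vertices (extended by zero to all subsets of `[n]`). Since
`C_j(Δ) / C_j(Γ)` is free on these faces, this is `Hom_ℤ (C_j(Δ) / C_j(Γ), k)`. -/
def relCochains {n : ℕ} (k : Type*) [Field k] (Δ Γ : Complex n) (j : ℤ) :
    Submodule k (Finset (Fin n) → k) where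
  carrier := {φ | ∀ E, φ E ≠ 0 → IsRelFace Δ Γ E ∧ (E.card : ℤ) = j + 1}
  zero_mem' := fun E h => absurd rfl h
  add_mem' := by
    intro φ ψ hφ hψ E h
    by_cases h0 : φ E = 0
    · refine hψ E fun h1 => h ?_
      simp [h0, h1]
    · exact hφ E h0
  smul_mem' := by
    intro c φ hφ E h
    refine hφ E fun h1 => h ?_
    simp [h1]

open Classical in
/-- The coboundary of relative cochains, dual to `∂ {i₀ < ... < iₜ} = ∑ⱼ (-1)ʲ {..., îⱼ, ...}`. -/
def relCoboundary {n : ℕ} (k : Type*) [Field k] (Δ Γ : Complex n) :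
    (Finset (Fin n) → k) →ₗ[k] (Finset (Fin n) → k) where
  toFun φ E := if IsRelFace Δ Γ E then
    ∑ v ∈ E, (-1 : k) ^ position E v * φ (E.erase v) else 0
  map_add' φ ψ := by
    funext E
    by_cases h : IsRelFace Δ Γ E
    · simp [h, mul_add, Finset.sum_add_distrib]
    · simp [h]
  map_smul' c φ := by
    funext E
    by_cases h : IsRelFace Δ Γ E
    · simp [h, Finset.mul_sum, mul_left_comm]
    · simp [h]

/-- Relative cocycles of degree `j`. -/
def relCocycles {n : ℕ} (k : Type*) [Field k] (Δ Γ : Complex n) (j : ℤ) :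
    Submodule k (Finset (Fin n) → k) :=
  relCochains k Δ Γ j ⊓ LinearMap.ker (relCoboundary k Δ Γ)

/-- Relative coboundaries of degree `j`. -/
def relCoboundaries {n : ℕ} (k : Type*) [Field k] (Δ Γ : Complex n) (j : ℤ) :
    Submodule k (Finset (Fin n) → k) :=
  (relCochains k Δ Γ (j - 1)).map (relCoboundary k Δ Γ)

/-- The reduced relative cohomology of `(Δ, Γ)` in degree `j`. -/
abbrev RelCohomology {n : ℕ} (k : Type*) [Field k] (Δ Γ : Complex n) (j : ℤ) : Type _ :=
  ↥(relCocycles k Δ Γ j) ⧸ (relCoboundaries k Δ Γ j).submoduleOf (relCocycles k Δ Γ j)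

open Classical in
/-- Restriction of cochains to the faces of the relative complex `(Δ, Γ)`. -/
def restrictFun {n : ℕ} (k : Type*) [Field k] (Δ Γ : Complex n) :
    (Finset (Fin n) → k) →ₗ[k] (Finset (Fin n) → k) where
  toFun φ E := if IsRelFace Δ Γ E then φ E else 0
  map_add' φ ψ := by
    funext E
    by_cases h : IsRelFace Δ Γ E <;> simp [h]
  map_smul' c φ := by
    funext E
    by_cases h : IsRelFace Δ Γ E <;> simp [h]

theorem restrictFun_mem {n : ℕ} {k : Type*} [Field k] {Δ Γ Δ' Γ' : Complex n} {j : ℤ}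
    {φ : Finset (Fin n) → k} (h : φ ∈ relCochains k Δ Γ j) :
    restrictFun k Δ' Γ' φ ∈ relCochains k Δ' Γ' j := by
  intro E hE
  by_cases hf : IsRelFace Δ' Γ' E
  · refine ⟨hf, (h E ?_).2⟩
    simpa [restrictFun, hf] using hE
  · exact absurd (by simp [restrictFun, hf]) hE

/-- Restriction along an inclusion of pairs is a map of cochain complexes. -/
theorem relCoboundary_restrictFun {n : ℕ} {k : Type*} [Field k] {Δ Γ Δ' Γ' : Complex n}
    (hΔ : Δ' ≤ Δ) (hΓ : Γ' ≤ Γ) {j : ℤ} {φ : Finset (Fin n) → k}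
    (h : φ ∈ relCochains k Δ Γ j) :
    relCoboundary k Δ' Γ' (restrictFun k Δ' Γ' φ) =
      restrictFun k Δ' Γ' (relCoboundary k Δ Γ φ) := by
  classical
  have hz : ∀ E, E ∈ Γ → φ E = 0 := fun E hE => by
    by_contra h0
    exact (h E h0).1.2 hE
  funext E
  by_cases hE : IsRelFace Δ' Γ' E
  · have h1 : ∀ v ∈ E, restrictFun k Δ' Γ' φ (E.erase v) = φ (E.erase v) := by
      intro v _
      by_cases hv : IsRelFace Δ' Γ' (E.erase v)
      · simp [restrictFun, hv]
      · have hv' : E.erase v ∈ Γ' := by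
          by_contra hc
          exact hv ⟨Δ'.lower (Finset.erase_subset v E) hE.1, hc⟩
        rw [hz _ (hΓ hv')]
        simp [restrictFun, hv]
    have h2 : relCoboundary k Δ' Γ' (restrictFun k Δ' Γ' φ) E =
        ∑ v ∈ E, (-1 : k) ^ position E v * φ (E.erase v) := by
      change (if IsRelFace Δ' Γ' E then _ else _) = _
      rw [if_pos hE]
      exact Finset.sum_congr rfl fun v hv => by rw [h1 v hv]
    rw [h2]
    change _ = (if IsRelFace Δ' Γ' E then relCoboundary k Δ Γ φ E else 0)
    rw [if_pos hE]
    change _ = (if IsRelFace Δ Γ E then _ else _)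
    by_cases hE' : IsRelFace Δ Γ E
    · rw [if_pos hE']
    · rw [if_neg hE']
      have hE2 : E ∈ Γ := by
        by_contra hc
        exact hE' ⟨hΔ hE.1, hc⟩
      refine Finset.sum_eq_zero fun v _ => ?_
      rw [hz _ (Γ.lower (Finset.erase_subset v E) hE2), mul_zero]
  · simp [restrictFun, relCoboundary, hE]

/-- The map on cocycles given by restriction along an inclusion of pairs. -/
def relCocyclesRestrict {n : ℕ} (k : Type*) [Field k] {Δ Γ Δ' Γ' : Complex n}
    (hΔ : Δ' ≤ Δ) (hΓ : Γ' ≤ Γ) (j : ℤ) :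
    ↥(relCocycles k Δ Γ j) →ₗ[k] ↥(relCocycles k Δ' Γ' j) :=
  (restrictFun k Δ' Γ').restrict fun φ hφ => ⟨restrictFun_mem hφ.1, by
    have h0 : relCoboundary k Δ Γ φ = 0 := hφ.2
    change _ ∈ LinearMap.ker (relCoboundary k Δ' Γ')
    rw [LinearMap.mem_ker, relCoboundary_restrictFun hΔ hΓ hφ.1, h0, map_zero]⟩

/-- The map `H̃ʲ(Δ, Γ) → H̃ʲ(Δ', Γ')` induced by inclusions `Δ' ⊆ Δ` and `Γ' ⊆ Γ`. -/
def relRestriction {n : ℕ} (k : Type*) [Field k] {Δ Γ Δ' Γ' : Complex n}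
    (hΔ : Δ' ≤ Δ) (hΓ : Γ' ≤ Γ) (j : ℤ) :
    RelCohomology k Δ Γ j →ₗ[k] RelCohomology k Δ' Γ' j :=
  Submodule.mapQ _ _ (relCocyclesRestrict k hΔ hΓ j) (by
    rintro φ ⟨ψ, hψ, hψφ⟩
    refine ⟨restrictFun k Δ' Γ' ψ, restrictFun_mem hψ, ?_⟩
    rw [relCoboundary_restrictFun hΔ hΓ hψ, hψφ]
    rfl)

/-! ### Monomial ideals and degree complexes -/

/-- A monomial ideal of `k[x₁, ..., xₙ]`. -/
def IsMonomialIdeal {n : ℕ} {k : Type*} [Field k] (I : Ideal (MvPolynomial (Fin n) k)) : Prop :=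
  ∃ A : Set (Fin n →₀ ℕ), I = Ideal.span ((fun c => monomial c (1 : k)) '' A)

/-- `x^c` is a minimal monomial generator of the monomial ideal `I`: a monomial in `I` which is
minimal with respect to divisibility. -/
def IsMinGen {n : ℕ} {k : Type*} [Field k] (I : Ideal (MvPolynomial (Fin n) k))
    (c : Fin n →₀ ℕ) : Prop :=
  Minimal (fun c : Fin n →₀ ℕ => monomial c (1 : k) ∈ I) c

/-- `G_a = {v | a_v < 0}`. -/
def negSupport {n : ℕ} (a : Fin n → ℤ) : Finset (Fin n) :=
  Finset.univ.filter (fun v => a v < 0)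

/-- The degree complex `Δ_a(I)`. -/
def degreeComplex {n : ℕ} {k : Type*} [Field k] (I : Ideal (MvPolynomial (Fin n) k))
    (a : Fin n → ℤ) : Complex n where
  carrier := {E | Disjoint E (negSupport a) ∧
    ∀ c, IsMinGen I c → ∃ v, v ∉ E ∪ negSupport a ∧ a v < (c v : ℤ)}
  lower' := by
    rintro E E' hE' ⟨h1, h2⟩
    refine ⟨Finset.disjoint_of_subset_left hE' h1, fun c hc => ?_⟩
    obtain ⟨v, hv, hav⟩ := h2 c hc
    exact ⟨v, fun h => hv (Finset.union_subset_union_left hE' h), hav⟩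

/-- The degree `a + b` for `b ∈ ℕⁿ`. -/
def addDegree {n : ℕ} (a : Fin n → ℤ) (b : Fin n →₀ ℕ) : Fin n → ℤ :=
  fun v => a v + (b v : ℤ)

/-- `Δ_{a+b}(I) ⊆ Δ_a(I)` if `G_{a+b} = G_a`. -/
theorem degreeComplex_addDegree_le {n : ℕ} {k : Type*} [Field k]
    (I : Ideal (MvPolynomial (Fin n) k)) {a : Fin n → ℤ} {b : Fin n →₀ ℕ}
    (h : negSupport (addDegree a b) = negSupport a) :
    degreeComplex I (addDegree a b) ≤ degreeComplex I a := by
  rintro E ⟨h1, h2⟩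
  rw [h] at h1 h2
  refine ⟨h1, fun c hc => ?_⟩
  obtain ⟨v, hv, hav⟩ := h2 c hc
  refine ⟨v, hv, ?_⟩
  unfold addDegree at hav
  omega

/-! ### The Čech complex and local cohomology -/

/-- The monomials `x^d` with `d` supported in `F`. -/
def monomialsOn {n : ℕ} (k : Type*) [Field k] (F : Finset (Fin n)) :
    Submonoid (MvPolynomial (Fin n) k) where
  carrier := {s | ∃ d : Fin n →₀ ℕ, d.support ⊆ F ∧ s = monomial d 1}
  one_mem' := ⟨0, by simp, rfl⟩
  mul_mem' := by
    rintro _ _ ⟨d, hd, rfl⟩ ⟨e, he, rfl⟩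
    refine ⟨d + e, ?_, by simp [monomial_mul]⟩
    exact Finsupp.support_add.trans (Finset.union_subset hd he)

/-- The monomial `x^d` as an element of `monomialsOn k F`, for `d` supported in `F`. -/
def denom {n : ℕ} (k : Type*) [Field k] {F : Finset (Fin n)} (d : Fin n →₀ ℕ)
    (hd : d.support ⊆ F) : monomialsOn k F :=
  ⟨monomial d 1, d, hd, rfl⟩

theorem monomialsOn_mono {n : ℕ} (k : Type*) [Field k] {F F' : Finset (Fin n)} (h : F ⊆ F') :
    monomialsOn k F ≤ monomialsOn k F' := by
  rintro _ ⟨d, hd, rfl⟩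
  exact ⟨d, hd.trans h, rfl⟩

/-- The localization `M_{x_F}`, where `x_F = ∏_{i ∈ F} x_i`: all `x_i` with `i ∈ F` are inverted,
and every monomial in these variables is allowed as a denominator. -/
abbrev Loc {n : ℕ} (k : Type*) [Field k] (M : Type*) [AddCommGroup M]
    [Module (MvPolynomial (Fin n) k) M] (F : Finset (Fin n)) : Type _ :=
  LocalizedModule (monomialsOn k F) M

/-- The localization map `M_{x_F} → M_{x_F'}` for `F ⊆ F'`. -/
def locMap {n : ℕ} (k : Type*) [Field k] (M : Type*) [AddCommGroup M]
    [Module (MvPolynomial (Fin n) k) M] {F F' : Finset (Fin n)} (h : F ⊆ F') :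
    Loc k M F →ₗ[MvPolynomial (Fin n) k] Loc k M F' :=
  IsLocalizedModule.liftOfLE (monomialsOn k F) (monomialsOn k F') (monomialsOn_mono k h)
    (LocalizedModule.mkLinearMap (monomialsOn k F) M)
    (LocalizedModule.mkLinearMap (monomialsOn k F') M)

/-- The direct sum of all terms of the Čech complex `Č(x₁, ..., xₙ; M)`. -/
abbrev CechTotal {n : ℕ} (k : Type*) [Field k] (M : Type*) [AddCommGroup M]
    [Module (MvPolynomial (Fin n) k) M] : Type _ :=
  (F : Finset (Fin n)) → Loc k M F

/-- The term `⨁_{|F| = i} M_{x_F}` of the Čech complex. -/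
def cechCochains {n : ℕ} (k : Type*) [Field k] (M : Type*) [AddCommGroup M]
    [Module (MvPolynomial (Fin n) k) M] (i : ℕ) :
    Submodule (MvPolynomial (Fin n) k) (CechTotal (n := n) k M) where
  carrier := {z | ∀ F, F.card ≠ i → z F = 0}
  zero_mem' := fun _ _ => rfl
  add_mem' := by
    intro z w hz hw F hF
    simp [hz F hF, hw F hF]
  smul_mem' := by
    intro c z hz F hF
    simp [hz F hF]

/-- The Čech differential. -/
def cechD {n : ℕ} (k : Type*) [Field k] (M : Type*) [AddCommGroup M]
    [Module (MvPolynomial (Fin n) k) M] :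
    CechTotal (n := n) k M →ₗ[MvPolynomial (Fin n) k] CechTotal (n := n) k M :=
  LinearMap.pi fun F => ∑ v ∈ F,
    (-1 : ℤ) ^ position F v • (locMap k M (F.erase_subset v) ∘ₗ LinearMap.proj (F.erase v))

/-- Čech cocycles of degree `i`. -/
def cechCocycles {n : ℕ} (k : Type*) [Field k] (M : Type*) [AddCommGroup M]
    [Module (MvPolynomial (Fin n) k) M] (i : ℕ) :
    Submodule (MvPolynomial (Fin n) k) (CechTotal (n := n) k M) :=
  cechCochains k M i ⊓ LinearMap.ker (cechD k M)

/-- Čech coboundaries of degree `i`: the images of the cochains of degree `i - 1`; for `i = 0`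
there are none but `0`. -/
def cechCoboundaries {n : ℕ} (k : Type*) [Field k] (M : Type*) [AddCommGroup M]
    [Module (MvPolynomial (Fin n) k) M] :
    ℕ → Submodule (MvPolynomial (Fin n) k) (CechTotal (n := n) k M)
  | 0 => ⊥
  | i + 1 => (cechCochains k M i).map (cechD k M)

/-- The local cohomology module `Hⁱ_𝔪(M)` with respect to `𝔪 = (x₁, ..., xₙ)`, as the cohomology
of the Čech complex on `x₁, ..., xₙ`. -/
abbrev LocalCohomology {n : ℕ} (k : Type*) [Field k] (M : Type*) [AddCommGroup M]
    [Module (MvPolynomial (Fin n) k) M] (i : ℕ) : Type _ :=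
  ↥(cechCocycles (n := n) k M i) ⧸
    (cechCoboundaries (n := n) k M i).submoduleOf (cechCocycles (n := n) k M i)

/-! ### The `ℤⁿ`-grading for `M = I / J` -/

/-- The module `I / J`. -/
abbrev IdealQuotient {n : ℕ} {k : Type*} [Field k] (I J : Ideal (MvPolynomial (Fin n) k)) :
    Type _ :=
  ↥I ⧸ Submodule.submoduleOf J I

/-- The fractions `[x^c] / x^d` in `(I / J)_{x_F}` with `x^c ∈ I` and `c - d = a`. Any two of them
are equal, so this is the set that contains the class of the Laurent monomial `x^a` if
`x^a ∈ I S_{x_F}`, and is empty otherwise. -/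
def laurentClass {n : ℕ} {k : Type*} [Field k] (I J : Ideal (MvPolynomial (Fin n) k))
    (F : Finset (Fin n)) (a : Fin n → ℤ) : Set (Loc k (IdealQuotient I J) F) :=
  {u | ∃ (c d : Fin n →₀ ℕ) (hc : monomial c (1 : k) ∈ I) (hd : d.support ⊆ F),
    (∀ v, (c v : ℤ) - (d v : ℤ) = a v) ∧
    u = LocalizedModule.mk (Submodule.Quotient.mk ⟨monomial c 1, hc⟩) (denom k d hd)}

/-- The component of degree `a` of `(I / J)_{x_F}`. -/
def locPiece {n : ℕ} {k : Type*} [Field k] (I J : Ideal (MvPolynomial (Fin n) k))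
    (F : Finset (Fin n)) (a : Fin n → ℤ) : Submodule k (Loc k (IdealQuotient I J) F) :=
  Submodule.span k (laurentClass I J F a)

/-- The Čech cocycles of degree `i` all of whose components are homogeneous of degree `a`. -/
def cocyclePiece {n : ℕ} {k : Type*} [Field k] (I J : Ideal (MvPolynomial (Fin n) k))
    (i : ℕ) (a : Fin n → ℤ) : Submodule k ↥(cechCocycles (n := n) k (IdealQuotient I J) i) where
  carrier := {z | ∀ F, z.1 F ∈ locPiece I J F a}
  zero_mem' := fun _ => zero_mem _
  add_mem' := fun hz hw F => add_mem (hz F) (hw F)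
  smul_mem' := fun c _ hz F => Submodule.smul_mem _ c (hz F)

/-- The class in `Hⁱ_𝔪(M)` of a Čech cocycle. -/
def cechClass {n : ℕ} (k : Type*) [Field k] (M : Type*) [AddCommGroup M]
    [Module (MvPolynomial (Fin n) k) M] (i : ℕ) :
    ↥(cechCocycles (n := n) k M i) →ₗ[MvPolynomial (Fin n) k] LocalCohomology (n := n) k M i :=
  Submodule.mkQ _

/-- The component `Hⁱ_𝔪(I / J)_a`: the classes of the homogeneous cocycles of degree `a`. -/
def cohomologyPiece {n : ℕ} {k : Type*} [Field k] (I J : Ideal (MvPolynomial (Fin n) k))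
    (i : ℕ) (a : Fin n → ℤ) : Submodule k (LocalCohomology (n := n) k (IdealQuotient I J) i) :=
  (cocyclePiece I J i a).map ((cechClass k (IdealQuotient I J) i).restrictScalars k)

theorem smul_mem_locPiece {n : ℕ} {k : Type*} [Field k] (I J : Ideal (MvPolynomial (Fin n) k))
    (F : Finset (Fin n)) (a : Fin n → ℤ) (b : Fin n →₀ ℕ) {u : Loc k (IdealQuotient I J) F}
    (hu : u ∈ locPiece I J F a) :
    monomial b (1 : k) • u ∈ locPiece I J F (addDegree a b) := by
  unfold locPiece at hu
  induction hu using Submodule.span_induction with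
  | mem u hu =>
    obtain ⟨c, d, hc, hd, hcd, rfl⟩ := hu
    refine Submodule.subset_span ⟨b + c, d, ?_, hd, fun v => ?_, ?_⟩
    · have h := I.mul_mem_left (monomial b (1 : k)) hc
      rwa [monomial_mul, one_mul] at h
    · have h := hcd v
      simp only [addDegree, Finsupp.add_apply]
      push_cast
      omega
    · rw [LocalizedModule.smul'_mk, ← Submodule.Quotient.mk_smul]
      congr 2
      apply Subtype.ext
      simp [monomial_mul]
  | zero => rw [smul_zero]; exact zero_mem _
  | add u w _ _ hu hw => rw [smul_add]; exact add_mem hu hw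
  | smul r u _ hu =>
    rw [smul_comm]
    exact Submodule.smul_mem _ r hu

theorem smul_mem_cohomologyPiece {n : ℕ} {k : Type*} [Field k]
    (I J : Ideal (MvPolynomial (Fin n) k)) (i : ℕ) (a : Fin n → ℤ) (b : Fin n →₀ ℕ)
    {h : LocalCohomology (n := n) k (IdealQuotient I J) i}
    (hh : h ∈ cohomologyPiece I J i a) :
    monomial b (1 : k) • h ∈ cohomologyPiece I J i (addDegree a b) := by
  obtain ⟨z, hz, rfl⟩ := hh
  exact ⟨monomial b (1 : k) • z, fun F => smul_mem_locPiece I J F a b (hz F), rfl⟩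

/-- Multiplication by `x^b`, as a `k`-linear map `Hⁱ_𝔪(I / J)_a → Hⁱ_𝔪(I / J)_{a+b}`. -/
def mulMonomial {n : ℕ} {k : Type*} [Field k] (I J : Ideal (MvPolynomial (Fin n) k))
    (i : ℕ) (a : Fin n → ℤ) (b : Fin n →₀ ℕ) :
    ↥(cohomologyPiece I J i a) →ₗ[k] ↥(cohomologyPiece I J i (addDegree a b)) where
  toFun h := ⟨monomial b (1 : k) • h.1, smul_mem_cohomologyPiece I J i a b h.2⟩
  map_add' _ _ := Subtype.ext (smul_add _ _ _)
  map_smul' r h := Subtype.ext (smul_algebra_smul_comm r (monomial b (1 : k)) h.1)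

/-! ### The relative Hochster-Takayama isomorphism -/

/-- A Čech cocycle `z` of degree `a` and a cochain `φ` of `(Δ_a(J), Δ_a(I))` correspond to each
other: the component of `z` at `G_a ∪ E`, for `E` disjoint from `G_a`, is `± φ(E)` times the class
of the Laurent monomial `x^a` (wherever that class is defined). The sign makes the correspondence
compatible with the two differentials. -/
def Corresponds {n : ℕ} {k : Type*} [Field k] (I J : Ideal (MvPolynomial (Fin n) k))
    (a : Fin n → ℤ) (z : CechTotal (n := n) k (IdealQuotient I J))
    (φ : Finset (Fin n) → k) : Prop :=
  ∀ E : Finset (Fin n), Disjoint E (negSupport a) →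
    ∀ u ∈ laurentClass I J (negSupport a ∪ E) a,
      z (negSupport a ∪ E) = ((-1 : k) ^ crossings (negSupport a) E * φ E) • u

/-- `Θ` is the relative Hochster-Takayama isomorphism: it sends the class of every homogeneous
cocycle to the class of the corresponding relative cocycle. As every element of `Hⁱ_𝔪(I / J)_a`
is such a class, there is at most one `Θ` with this property. -/
def IsHochsterTakayama {n : ℕ} {k : Type*} [Field k] (I J : Ideal (MvPolynomial (Fin n) k))
    (i : ℕ) (a : Fin n → ℤ) (j : ℤ)
    (Θ : ↥(cohomologyPiece I J i a) ≃ₗ[k]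
      RelCohomology k (degreeComplex J a) (degreeComplex I a) j) : Prop :=
  ∀ (z : ↥(cechCocycles (n := n) k (IdealQuotient I J) i)) (hz : z ∈ cocyclePiece I J i a),
    ∃ φ : ↥(relCocycles k (degreeComplex J a) (degreeComplex I a) j),
      Corresponds I J a z.1 φ.1 ∧
      Θ ⟨cechClass k (IdealQuotient I J) i z, z, hz, rfl⟩ = Submodule.Quotient.mk φ

end RelativeTakayama

end

/-!
# The relative Hochster-Takayama isomorphism and multiplication by monomials

In degree `a`, the module `(I / J)_{x_F}` is one-dimensional, spanned by the class of `x^a`, if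
`x^a` lies in `I S_{x_F}` but not in `J S_{x_F}`, and it is zero otherwise. For `F = G_a ∪ E` with
`E` disjoint from `G_a` the first case says that `E` is a face of `(Δ_a(J), Δ_a(I))`
(`mem_degreeComplex_iff`), and the component is zero if `F` does not contain `G_a`
(`laurentNotMem_of_not_subset`). Thus the degree `a` part of the Čech complex is, up to signs and
a shift by `|G_a|`, the complex of relative cochains.

The comparison is given by extracting coefficients. The coefficient at `x^a` is a `k`-linear
functional `laurentCoeff` on the whole of `(I / J)_{x_F}`, not only on its homogeneous part, and it
is compatible with localization maps and with multiplication by monomials. The resulting map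
`takayamaCochain` is therefore a cochain map on all Čech cochains (`takayamaCochain_cechD`). It
induces a map on all of `Hⁱ_𝔪(I / J)`, so a homogeneous cocycle that bounds an inhomogeneous
cochain needs no separate treatment. On homogeneous cochains it is injective
(`eq_zero_of_takayamaCochain`), and `homogeneousCochain` is a section of it; together these make
the induced map bijective on the component of degree `a` (`takayamaMap_bijective`).

Multiplication by `x^b` carries the coefficient at `x^a` to the coefficient at `x^{a + b}`, so it
corresponds to restriction of cochains already before passing to cohomology
(`takayamaCochain_monomial_smul`).
-/

noncomputable section

namespace RelativeTakayama

open MvPolynomial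

/-! ### Monomials in localized monomial ideals -/

/-- The condition `x^a ∉ K S_{x_F}`: no monomial of `K` has the form `x^{a + d}` with `d ∈ ℕⁿ`
supported in `F`. -/
def LaurentNotMem {n : ℕ} {k : Type*} [Field k] (K : Ideal (MvPolynomial (Fin n) k))
    (F : Finset (Fin n)) (a : Fin n → ℤ) : Prop :=
  ∀ c d : Fin n →₀ ℕ, d.support ⊆ F → (∀ v, (c v : ℤ) - (d v : ℤ) = a v) →
    monomial c (1 : k) ∉ K

theorem LaurentNotMem.mono {n : ℕ} {k : Type*} [Field k] {K : Ideal (MvPolynomial (Fin n) k)}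
    {F F' : Finset (Fin n)} {a : Fin n → ℤ} (h : LaurentNotMem K F' a) (hF : F ⊆ F') :
    LaurentNotMem K F a :=
  fun c d hd hcd => h c d (hd.trans hF) hcd

theorem monomial_mem_of_le {n : ℕ} {k : Type*} [Field k] {K : Ideal (MvPolynomial (Fin n) k)}
    {c c' : Fin n →₀ ℕ} (h : c' ≤ c) (hc : monomial c' (1 : k) ∈ K) :
    monomial c (1 : k) ∈ K := by
  have h1 := K.mul_mem_left (monomial (c - c') (1 : k)) hc
  rwa [monomial_mul, one_mul, tsub_add_cancel_of_le h] at h1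

theorem IsMonomialIdeal.monomial_mem {n : ℕ} {k : Type*} [Field k]
    {K : Ideal (MvPolynomial (Fin n) k)} (hK : IsMonomialIdeal K)
    {p : MvPolynomial (Fin n) k} (hp : p ∈ K) {c : Fin n →₀ ℕ} (hc : coeff c p ≠ 0) :
    monomial c (1 : k) ∈ K := by
  obtain ⟨A, rfl⟩ := hK
  obtain ⟨s, hs, hsc⟩ := mem_ideal_span_monomial_image.1 hp c (mem_support_iff.2 hc)
  exact monomial_mem_of_le hsc (Ideal.subset_span ⟨s, hs, rfl⟩)

/-- Membership in the degree complex says that `x^a` is not in the localized ideal. It suffices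
to test minimal generators because divisibility of monomials is well-founded. -/
theorem mem_degreeComplex_iff {n : ℕ} {k : Type*} [Field k] (K : Ideal (MvPolynomial (Fin n) k))
    (a : Fin n → ℤ) {E : Finset (Fin n)} (hE : Disjoint E (negSupport a)) :
    E ∈ degreeComplex K a ↔ LaurentNotMem K (negSupport a ∪ E) a := by
  constructor
  · rintro ⟨-, h⟩ c d hd hcd hc
    obtain ⟨c', hc'c, hc'⟩ := exists_minimal_le_of_wellFoundedLT
      (fun c : Fin n →₀ ℕ => monomial c (1 : k) ∈ K) c hc
    obtain ⟨v, hv, hav⟩ := h c' hc'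
    have hdv : d v = 0 := by
      by_contra h0
      exact hv (Finset.union_comm E _ ▸ hd (Finsupp.mem_support_iff.2 h0))
    have h1 := hcd v
    have h2 := hc'c v
    omega
  · intro h
    refine ⟨hE, fun c' hc' => ?_⟩
    by_contra! hcon
    -- The least `d` supported in `F` such that `a + d` is a multiple of `c'`.
    let d : Fin n →₀ ℕ := Finsupp.equivFunOnFinite.symm fun v => ((c' v : ℤ) - a v).toNat
    have hd : ∀ v, d v = ((c' v : ℤ) - a v).toNat := fun v => rfl
    let c : Fin n →₀ ℕ := Finsupp.equivFunOnFinite.symm fun v => (a v + d v).toNat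
    have hc : ∀ v, c v = (a v + d v).toNat := fun v => rfl
    refine h c d (fun v hv => ?_) (fun v => ?_) (monomial_mem_of_le (fun v => ?_) hc'.1)
    · by_contra h0
      have h1 := hcon v (by rwa [Finset.union_comm])
      have h2 := hd v
      exact Finsupp.mem_support_iff.1 hv (by omega)
    · have h1 := hc v
      have h2 := hd v
      omega
    · have h1 := hc v
      have h2 := hd v
      omega

/-! ### Coefficients of fractions at Laurent monomials -/

open Classical in
/-- The coefficient of a polynomial at `x^e` for `e ∈ ℤⁿ`; it is zero if `e ∉ ℕⁿ`. -/
def intCoeff {n : ℕ} (k : Type*) [Field k] (e : Fin n → ℤ) : MvPolynomial (Fin n) k →ₗ[k] k :=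
  if h : ∃ c : Fin n →₀ ℕ, ∀ v, (c v : ℤ) = e v then lcoeff k h.choose else 0

theorem intCoeff_eq_coeff {n : ℕ} {k : Type*} [Field k] {e : Fin n → ℤ} {c : Fin n →₀ ℕ}
    (h : ∀ v, (c v : ℤ) = e v) (p : MvPolynomial (Fin n) k) : intCoeff k e p = coeff c p := by
  have h' : ∃ c : Fin n →₀ ℕ, ∀ v, (c v : ℤ) = e v := ⟨c, h⟩
  have hc : h'.choose = c := by
    ext v
    have h1 := h'.choose_spec v
    have h2 := h v
    omega
  rw [intCoeff, dif_pos h', hc, lcoeff_apply]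

theorem intCoeff_ne_zero {n : ℕ} {k : Type*} [Field k] {e : Fin n → ℤ}
    {p : MvPolynomial (Fin n) k} (h : intCoeff k e p ≠ 0) :
    ∃ c : Fin n →₀ ℕ, (∀ v, (c v : ℤ) = e v) ∧ coeff c p ≠ 0 := by
  by_cases h' : ∃ c : Fin n →₀ ℕ, ∀ v, (c v : ℤ) = e v
  · obtain ⟨c, hc⟩ := h'
    exact ⟨c, hc, by rwa [intCoeff_eq_coeff hc] at h⟩
  · rw [intCoeff, dif_neg h'] at h
    exact absurd rfl h

theorem addDegree_add {n : ℕ} (a : Fin n → ℤ) (d e : Fin n →₀ ℕ) :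
    addDegree a (d + e) = addDegree (addDegree a d) e := by
  funext v
  simp [addDegree, add_assoc]

theorem addDegree_right_comm {n : ℕ} (a : Fin n → ℤ) (d e : Fin n →₀ ℕ) :
    addDegree (addDegree a d) e = addDegree (addDegree a e) d := by
  rw [← addDegree_add, add_comm, addDegree_add]

theorem intCoeff_monomial_mul {n : ℕ} {k : Type*} [Field k] (e : Fin n → ℤ) (d : Fin n →₀ ℕ)
    (p : MvPolynomial (Fin n) k) :
    intCoeff k (addDegree e d) (monomial d 1 * p) = intCoeff k e p := by
  by_cases h : ∃ c : Fin n →₀ ℕ, ∀ v, (c v : ℤ) = e v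
  · obtain ⟨c, hc⟩ := h
    rw [intCoeff_eq_coeff hc, intCoeff_eq_coeff (c := d + c), coeff_monomial_mul, one_mul]
    intro v
    simp [addDegree, hc v, add_comm]
  · have h0 : intCoeff k e p = 0 := by
      by_contra h0
      obtain ⟨c, hc, -⟩ := intCoeff_ne_zero h0
      exact h ⟨c, hc⟩
    rw [h0]
    by_contra h1
    obtain ⟨c, hc, hcp⟩ := intCoeff_ne_zero h1
    rw [coeff_monomial_mul'] at hcp
    have hdc : d ≤ c := by
      by_contra hdc
      exact hcp (if_neg hdc)
    refine h ⟨c - d, fun v => ?_⟩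
    have h2 := hc v
    have h3 := hdc v
    simp only [addDegree] at h2
    rw [Finsupp.tsub_apply]
    omega

/-- If `x^a ∉ K S_{x_F}` for a monomial ideal `K`, then no element of `K` involves a monomial
`x^{a + d}` with `d` supported in `F`. -/
theorem LaurentNotMem.intCoeff_eq_zero {n : ℕ} {k : Type*} [Field k]
    {K : Ideal (MvPolynomial (Fin n) k)} {F : Finset (Fin n)} {a : Fin n → ℤ}
    (h : LaurentNotMem K F a) (hK : IsMonomialIdeal K) {p : MvPolynomial (Fin n) k} (hp : p ∈ K)
    {d : Fin n →₀ ℕ} (hd : d.support ⊆ F) : intCoeff k (addDegree a d) p = 0 := by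
  by_contra h0
  obtain ⟨c, hc, hcp⟩ := intCoeff_ne_zero h0
  refine h c d hd (fun v => ?_) (hK.monomial_mem hp hcp)
  rw [hc v, addDegree]
  ring

/-- The fraction `p / x^d` in `(I / J)_{x_F}`. -/
def fraction {n : ℕ} {k : Type*} [Field k] {I : Ideal (MvPolynomial (Fin n) k)}
    (J : Ideal (MvPolynomial (Fin n) k)) {F : Finset (Fin n)} (p : I) (d : Fin n →₀ ℕ)
    (hd : d.support ⊆ F) : Loc k (IdealQuotient I J) F :=
  LocalizedModule.mk (Submodule.Quotient.mk p) (denom k d hd)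

section Fractions

variable {n : ℕ} {k : Type*} [Field k] {I J : Ideal (MvPolynomial (Fin n) k)}
  {F : Finset (Fin n)}

theorem exists_eq_fraction (u : Loc k (IdealQuotient I J) F) :
    ∃ (p : I) (d : Fin n →₀ ℕ) (hd : d.support ⊆ F), u = fraction J p d hd := by
  induction u using LocalizedModule.induction_on with
  | h m s =>
    obtain ⟨p, rfl⟩ := Submodule.Quotient.mk_surjective _ m
    obtain ⟨s, d, hd, rfl⟩ := s
    exact ⟨p, d, hd, rfl⟩

theorem support_add_subset {d e : Fin n →₀ ℕ} (hd : d.support ⊆ F) (he : e.support ⊆ F) :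
    (d + e).support ⊆ F :=
  Finsupp.support_add.trans (Finset.union_subset hd he)

theorem fraction_eq_iff {p q : I} {d e : Fin n →₀ ℕ} {hd : d.support ⊆ F} {he : e.support ⊆ F} :
    fraction J p d hd = fraction J q e he ↔ ∃ t : Fin n →₀ ℕ, t.support ⊆ F ∧
      monomial (t + e) (1 : k) * p.1 - monomial (t + d) 1 * q.1 ∈ J := by
  have key : ∀ (t : Fin n →₀ ℕ) (ht : t.support ⊆ F),
      (denom k t ht • denom k e he • (Submodule.Quotient.mk p : IdealQuotient I J) =
        denom k t ht • denom k d hd • (Submodule.Quotient.mk q : IdealQuotient I J)) ↔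
      monomial (t + e) (1 : k) * p.1 - monomial (t + d) 1 * q.1 ∈ J := by
    intro t ht
    have h1 : ∀ (e : Fin n →₀ ℕ) (he : e.support ⊆ F) (p : I),
        denom k t ht • denom k e he • (Submodule.Quotient.mk p : IdealQuotient I J) =
        Submodule.Quotient.mk ((monomial (t + e) (1 : k)) • p) := by
      intro e he p
      rw [smul_smul, Submonoid.smul_def, Submodule.Quotient.mk_smul]
      congr 1
      simp [denom, monomial_mul]
    rw [h1, h1, Submodule.Quotient.eq]
    rfl
  rw [fraction, fraction, LocalizedModule.mk_eq]
  constructor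
  · rintro ⟨⟨_, t, ht, rfl⟩, h⟩
    exact ⟨t, ht, (key t ht).1 h⟩
  · rintro ⟨t, ht, h⟩
    exact ⟨denom k t ht, (key t ht).2 h⟩

theorem fraction_add {p q : I} {d e : Fin n →₀ ℕ} {hd : d.support ⊆ F} {he : e.support ⊆ F} :
    fraction J p d hd + fraction J q e he =
      fraction J (monomial e (1 : k) • p + monomial d (1 : k) • q) (d + e)
        (support_add_subset hd he) := by
  rw [fraction, fraction, LocalizedModule.mk_add_mk, fraction]
  congr 1
  apply Subtype.ext
  simp [denom, monomial_mul]

theorem smul_fraction (r : k) {p : I} {d : Fin n →₀ ℕ} {hd : d.support ⊆ F} :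
    r • fraction J p d hd = fraction J (r • p) d hd := by
  rw [fraction, LocalizedModule.smul'_mk]
  rfl

theorem monomial_smul_fraction (b : Fin n →₀ ℕ) {p : I} {d : Fin n →₀ ℕ} {hd : d.support ⊆ F} :
    monomial b (1 : k) • fraction J p d hd = fraction J (monomial b (1 : k) • p) d hd := by
  rw [fraction, LocalizedModule.smul'_mk]
  rfl

theorem locMap_fraction {F' : Finset (Fin n)} (h : F ⊆ F') {p : I} {d : Fin n →₀ ℕ}
    {hd : d.support ⊆ F} :
    locMap k (IdealQuotient I J) h (fraction J p d hd) = fraction J p d (hd.trans h) := by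
  rw [fraction, IsLocalizedModule.mk_eq_mk', locMap, IsLocalizedModule.liftOfLE_mk', fraction,
    IsLocalizedModule.mk_eq_mk']
  rfl

/-- The coefficient of `p / x^d` at `x^a` does not depend on the fraction chosen. -/
theorem intCoeff_eq_of_fraction_eq {a : Fin n → ℤ} (hJ : IsMonomialIdeal J)
    (h : LaurentNotMem J F a) {p q : I} {d e : Fin n →₀ ℕ} {hd : d.support ⊆ F}
    {he : e.support ⊆ F} (hpq : fraction J p d hd = fraction J q e he) :
    intCoeff k (addDegree a d) p.1 = intCoeff k (addDegree a e) q.1 := by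
  obtain ⟨t, ht, hJt⟩ := fraction_eq_iff.1 hpq
  have h0 := h.intCoeff_eq_zero hJ hJt
    (support_add_subset (support_add_subset ht he) hd)
  rw [map_sub, sub_eq_zero] at h0
  have e1 : addDegree a (t + e + d) = addDegree (addDegree a d) (t + e) := by
    rw [addDegree_add, addDegree_right_comm]
  have e2 : addDegree a (t + e + d) = addDegree (addDegree a e) (t + d) := by
    rw [← addDegree_add]
    congr 1
    abel
  rwa [e1, intCoeff_monomial_mul, ← e1, e2, intCoeff_monomial_mul] at h0

end Fractions

open Classical in
/-- The coefficient at `x^a` of an element of `(I / J)_{x_F}`, computed from an arbitrary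
representation as a fraction. If `x^a ∈ J S_{x_F}` there is no such coefficient, and the value
is zero by convention. -/
def laurentCoeff {n : ℕ} {k : Type*} [Field k] {I J : Ideal (MvPolynomial (Fin n) k)}
    {F : Finset (Fin n)} (hJ : IsMonomialIdeal J) (a : Fin n → ℤ) :
    Loc k (IdealQuotient I J) F →ₗ[k] k where
  toFun u := if LaurentNotMem J F a then
    intCoeff k (addDegree a (exists_eq_fraction u).choose_spec.choose)
      (exists_eq_fraction u).choose.1 else 0
  map_add' u w := by
    by_cases h : LaurentNotMem J F a
    · simp only [if_pos h]
      obtain ⟨hd, hu⟩ := (exists_eq_fraction u).choose_spec.choose_spec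
      obtain ⟨he, hw⟩ := (exists_eq_fraction w).choose_spec.choose_spec
      obtain ⟨hf, huw⟩ := (exists_eq_fraction (u + w)).choose_spec.choose_spec
      have h1 := huw.symm.trans ((congrArg₂ (· + ·) hu hw).trans fraction_add)
      rw [intCoeff_eq_of_fraction_eq hJ h h1]
      simp only [Submodule.coe_add, Submodule.coe_smul, smul_eq_mul, map_add]
      congr 1
      · rw [addDegree_add, intCoeff_monomial_mul]
      · rw [addDegree_add, addDegree_right_comm, intCoeff_monomial_mul]
    · simp [h]
  map_smul' r u := by
    by_cases h : LaurentNotMem J F a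
    · simp only [if_pos h]
      obtain ⟨hd, hu⟩ := (exists_eq_fraction u).choose_spec.choose_spec
      obtain ⟨hf, hru⟩ := (exists_eq_fraction (r • u)).choose_spec.choose_spec
      have h1 := hru.symm.trans ((congrArg (r • ·) hu).trans (smul_fraction r))
      rw [intCoeff_eq_of_fraction_eq hJ h h1]
      exact map_smul _ _ _
    · simp [h]

section LaurentCoeff

variable {n : ℕ} {k : Type*} [Field k] {I J : Ideal (MvPolynomial (Fin n) k)}
  {F : Finset (Fin n)} {a : Fin n → ℤ}

open Classical in
theorem laurentCoeff_fraction (hJ : IsMonomialIdeal J) (h : LaurentNotMem J F a) (p : I)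
    (d : Fin n →₀ ℕ) (hd : d.support ⊆ F) :
    laurentCoeff hJ a (fraction J p d hd) = intCoeff k (addDegree a d) p.1 := by
  obtain ⟨he, hu⟩ := (exists_eq_fraction (fraction J p d hd)).choose_spec.choose_spec
  change ite _ _ _ = _
  rw [if_pos h]
  exact (intCoeff_eq_of_fraction_eq hJ h hu).symm

open Classical in
theorem laurentCoeff_eq_zero_of_not (hJ : IsMonomialIdeal J) (h : ¬ LaurentNotMem J F a)
    (u : Loc k (IdealQuotient I J) F) : laurentCoeff hJ a u = 0 := by
  change ite _ _ _ = _
  exact if_neg h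

/-- If `x^a ∉ I S_{x_F}`, the component of `(I / J)_{x_F}` in degree `a` vanishes. -/
theorem laurentCoeff_eq_zero (hI : IsMonomialIdeal I) (hJ : IsMonomialIdeal J)
    (h : LaurentNotMem I F a) (u : Loc k (IdealQuotient I J) F) : laurentCoeff hJ a u = 0 := by
  by_cases h' : LaurentNotMem J F a
  · obtain ⟨p, d, hd, rfl⟩ := exists_eq_fraction u
    rw [laurentCoeff_fraction hJ h', h.intCoeff_eq_zero hI p.2 hd]
  · exact laurentCoeff_eq_zero_of_not hJ h' u

theorem laurentCoeff_locMap (hJ : IsMonomialIdeal J) {F' : Finset (Fin n)} (hF : F ⊆ F')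
    (h : LaurentNotMem J F' a) (u : Loc k (IdealQuotient I J) F) :
    laurentCoeff hJ a (locMap k (IdealQuotient I J) hF u) = laurentCoeff hJ a u := by
  obtain ⟨p, d, hd, rfl⟩ := exists_eq_fraction u
  rw [locMap_fraction, laurentCoeff_fraction hJ h, laurentCoeff_fraction hJ (h.mono hF)]

theorem laurentCoeff_monomial_smul (hJ : IsMonomialIdeal J) (b : Fin n →₀ ℕ)
    (h : LaurentNotMem J F a) (h' : LaurentNotMem J F (addDegree a b))
    (u : Loc k (IdealQuotient I J) F) :
    laurentCoeff hJ (addDegree a b) (monomial b (1 : k) • u) = laurentCoeff hJ a u := by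
  obtain ⟨p, d, hd, rfl⟩ := exists_eq_fraction u
  rw [monomial_smul_fraction, laurentCoeff_fraction hJ h', laurentCoeff_fraction hJ h,
    addDegree_right_comm, Submodule.coe_smul, smul_eq_mul, intCoeff_monomial_mul]

/-- If `F` does not contain `G_a`, then `x^a` is not even in `S_{x_F}`. -/
theorem laurentNotMem_of_not_subset {K : Ideal (MvPolynomial (Fin n) k)}
    (h : ¬ negSupport a ⊆ F) : LaurentNotMem K F a := by
  intro c d hd hcd _
  refine h fun v hv => hd (Finsupp.mem_support_iff.2 fun h0 => ?_)
  have h1 := hcd v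
  have h2 : a v < 0 := (Finset.mem_filter.1 hv).2
  omega

theorem eq_of_mem_laurentClass {u w : Loc k (IdealQuotient I J) F}
    (hu : u ∈ laurentClass I J F a) (hw : w ∈ laurentClass I J F a) : u = w := by
  obtain ⟨c, d, hc, hd, hcd, rfl⟩ := hu
  obtain ⟨c', d', hc', hd', hcd', rfl⟩ := hw
  refine fraction_eq_iff.2 ⟨0, by simp, ?_⟩
  have h : d' + c = d + c' := by
    ext v
    have h1 := hcd v
    have h2 := hcd' v
    simp only [Finsupp.add_apply]
    omega
  simp [monomial_mul, h]

/-- The class of `x^a` vanishes in `(I / J)_{x_F}` if `x^a ∈ J S_{x_F}`. -/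
theorem eq_zero_of_mem_laurentClass {u : Loc k (IdealQuotient I J) F}
    (hu : u ∈ laurentClass I J F a) (h : ¬ LaurentNotMem J F a) : u = 0 := by
  obtain ⟨c, d, hc, hd, hcd, rfl⟩ := hu
  simp only [LaurentNotMem, not_forall, not_not] at h
  obtain ⟨c', d', hd', hcd', hc'⟩ := h
  have h0 : (0 : Loc k (IdealQuotient I J) F) = fraction J 0 0 (by simp) :=
    (LocalizedModule.zero_mk _).symm
  rw [h0]
  refine fraction_eq_iff.2 ⟨d', hd', ?_⟩
  have h : d' + c = d + c' := by
    ext v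
    have h1 := hcd v
    have h2 := hcd' v
    simp only [Finsupp.add_apply]
    omega
  have h3 := monomial_mem_of_le (le_add_self : c' ≤ d + c') hc'
  simpa [monomial_mul, h] using h3

theorem laurentCoeff_of_mem_laurentClass (hJ : IsMonomialIdeal J) (h : LaurentNotMem J F a)
    {u : Loc k (IdealQuotient I J) F} (hu : u ∈ laurentClass I J F a) :
    laurentCoeff hJ a u = 1 := by
  obtain ⟨c, d, hc, hd, hcd, rfl⟩ := hu
  refine (laurentCoeff_fraction hJ h ⟨monomial c 1, hc⟩ d hd).trans ?_
  rw [intCoeff_eq_coeff (c := c)]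
  · simp
  · intro v
    have h2 := hcd v
    simp only [addDegree]
    omega

/-- An element of degree `a` is its coefficient times the class of `x^a`. -/
theorem eq_laurentCoeff_smul (hJ : IsMonomialIdeal J) {u w : Loc k (IdealQuotient I J) F}
    (hu : u ∈ laurentClass I J F a) (hw : w ∈ locPiece I J F a) :
    w = laurentCoeff hJ a w • u := by
  have hs : laurentClass I J F a = {u} :=
    Set.eq_singleton_iff_unique_mem.2 ⟨hu, fun x hx => eq_of_mem_laurentClass hx hu⟩
  rw [locPiece, hs] at hw
  obtain ⟨r, rfl⟩ := Submodule.mem_span_singleton.1 hw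
  by_cases h : LaurentNotMem J F a
  · rw [map_smul, laurentCoeff_of_mem_laurentClass hJ h hu, smul_eq_mul, mul_one]
  · rw [eq_zero_of_mem_laurentClass hu h, smul_zero, smul_zero]

/-- A homogeneous element with zero coefficient vanishes. -/
theorem eq_zero_of_laurentCoeff (hJ : IsMonomialIdeal J) {w : Loc k (IdealQuotient I J) F}
    (hw : w ∈ locPiece I J F a) (h : laurentCoeff hJ a w = 0) : w = 0 := by
  rcases (laurentClass I J F a).eq_empty_or_nonempty with he | ⟨u, hu⟩
  · rw [locPiece, he, Submodule.span_empty] at hw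
    exact hw
  · rw [eq_laurentCoeff_smul hJ hu hw, h, zero_smul]

theorem laurentNotMem_or_nonempty (I J : Ideal (MvPolynomial (Fin n) k)) (F : Finset (Fin n))
    (a : Fin n → ℤ) : LaurentNotMem I F a ∨ (laurentClass I J F a).Nonempty := by
  by_cases h : LaurentNotMem I F a
  · exact Or.inl h
  · simp only [LaurentNotMem, not_forall, not_not] at h
    obtain ⟨c, d, hd, hcd, hc⟩ := h
    exact Or.inr ⟨_, c, d, hc, hd, hcd, rfl⟩

theorem locMap_mem_locPiece {F' : Finset (Fin n)} (hF : F ⊆ F')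
    {u : Loc k (IdealQuotient I J) F} (hu : u ∈ locPiece I J F a) :
    locMap k (IdealQuotient I J) hF u ∈ locPiece I J F' a := by
  unfold locPiece at hu
  induction hu using Submodule.span_induction with
  | mem u hu =>
    obtain ⟨c, d, hc, hd, hcd, rfl⟩ := hu
    exact Submodule.subset_span ⟨c, d, hc, hd.trans hF, hcd, locMap_fraction hF⟩
  | zero => rw [map_zero]; exact zero_mem _
  | add u w _ _ hu hw => rw [map_add]; exact add_mem hu hw
  | smul r u _ hu =>
    have h1 := (locMap k (IdealQuotient I J) hF).map_smul_of_tower r u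
    rw [h1]
    exact Submodule.smul_mem _ r hu

end LaurentCoeff

/-! ### Comparison of Čech cochains and relative cochains -/

theorem position_union {n : ℕ} {G E : Finset (Fin n)} (h : Disjoint E G) (v : Fin n) :
    position (G ∪ E) v = position G v + position E v := by
  rw [position, Finset.filter_union, Finset.card_union_of_disjoint
    (Finset.disjoint_filter_filter h.symm)]
  rfl

theorem crossings_erase {n : ℕ} (G : Finset (Fin n)) {E : Finset (Fin n)} {v : Fin n}
    (hv : v ∈ E) : crossings G E = crossings G (E.erase v) + position G v :=
  (Finset.sum_erase_add E (position G) hv).symm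

theorem neg_one_pow_mul_self {k : Type*} [Field k] (m : ℕ) :
    (-1 : k) ^ m * (-1 : k) ^ m = 1 := by
  rw [← mul_pow, neg_one_mul, neg_neg, one_pow]

section Comparison

variable {n : ℕ} {k : Type*} [Field k] {I J : Ideal (MvPolynomial (Fin n) k)}

theorem isRelFace_iff {a : Fin n → ℤ} {E : Finset (Fin n)} (hE : Disjoint E (negSupport a)) :
    IsRelFace (degreeComplex J a) (degreeComplex I a) E ↔
      LaurentNotMem J (negSupport a ∪ E) a ∧ ¬ LaurentNotMem I (negSupport a ∪ E) a := by
  rw [IsRelFace, mem_degreeComplex_iff J a hE, mem_degreeComplex_iff I a hE]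

/-- The cochain of `(Δ_a(J), Δ_a(I))` whose value on `E` is, up to the sign of
`Corresponds`, the coefficient at `x^a` of the component of a Čech cochain at `G_a ∪ E`. It is
defined for all Čech cochains, not only for the homogeneous ones. -/
def takayamaCochain (hJ : IsMonomialIdeal J) (a : Fin n → ℤ) :
    CechTotal (n := n) k (IdealQuotient I J) →ₗ[k] (Finset (Fin n) → k) where
  toFun z E := if Disjoint E (negSupport a) then
    (-1 : k) ^ crossings (negSupport a) E * laurentCoeff hJ a (z (negSupport a ∪ E)) else 0
  map_add' z w := by
    funext E
    by_cases h : Disjoint E (negSupport a) <;> simp [h, mul_add]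
  map_smul' r z := by
    funext E
    by_cases h : Disjoint E (negSupport a) <;> simp [h, mul_left_comm]

theorem takayamaCochain_of_disjoint (hJ : IsMonomialIdeal J) {a : Fin n → ℤ}
    (z : CechTotal (n := n) k (IdealQuotient I J)) {E : Finset (Fin n)}
    (h : Disjoint E (negSupport a)) : takayamaCochain hJ a z E =
      (-1 : k) ^ crossings (negSupport a) E * laurentCoeff hJ a (z (negSupport a ∪ E)) :=
  if_pos h

theorem isRelFace_of_takayamaCochain_ne_zero (hI : IsMonomialIdeal I) (hJ : IsMonomialIdeal J)
    {a : Fin n → ℤ} {z : CechTotal (n := n) k (IdealQuotient I J)} {E : Finset (Fin n)}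
    (h : takayamaCochain hJ a z E ≠ 0) :
    IsRelFace (degreeComplex J a) (degreeComplex I a) E := by
  by_cases hE : Disjoint E (negSupport a)
  · rw [takayamaCochain_of_disjoint hJ z hE] at h
    refine (isRelFace_iff hE).2 ⟨?_, fun hc => ?_⟩
    · by_contra hc
      exact right_ne_zero_of_mul h (laurentCoeff_eq_zero_of_not hJ hc _)
    · exact right_ne_zero_of_mul h (laurentCoeff_eq_zero hI hJ hc _)
  · exact absurd (if_neg hE) h

theorem takayamaCochain_mem (hI : IsMonomialIdeal I) (hJ : IsMonomialIdeal J) {a : Fin n → ℤ}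
    {i : ℕ} {z : CechTotal (n := n) k (IdealQuotient I J)}
    (hz : z ∈ cechCochains k (IdealQuotient I J) i) {j : ℤ}
    (hj : j = i - ((negSupport a).card : ℤ) - 1) :
    takayamaCochain hJ a z ∈ relCochains k (degreeComplex J a) (degreeComplex I a) j := by
  intro E hE
  have hf := isRelFace_of_takayamaCochain_ne_zero hI hJ hE
  have hd : Disjoint E (negSupport a) := hf.1.1
  refine ⟨hf, ?_⟩
  by_contra hc
  rw [takayamaCochain_of_disjoint hJ z hd, hz _ ?_, map_zero, mul_zero] at hE
  · exact hE rfl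
  · rw [Finset.card_union_of_disjoint hd.symm]
    omega

theorem cechD_apply (z : CechTotal (n := n) k (IdealQuotient I J)) (F : Finset (Fin n)) :
    cechD k (IdealQuotient I J) z F = ∑ v ∈ F, (-1 : ℤ) ^ position F v •
      locMap k (IdealQuotient I J) (F.erase_subset v) (z (F.erase v)) := by
  simp only [cechD, LinearMap.pi_apply, LinearMap.sum_apply]
  rfl

/-- The comparison is a cochain map. Writing `F = G_a ∪ E`, the position of `v ∈ E` in `F` is the
sum of its positions in `G_a` and in `E`, and the first of these is the change of the sign
`(-1) ^ crossings`. -/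
theorem takayamaCochain_cechD (hI : IsMonomialIdeal I) (hJ : IsMonomialIdeal J)
    (a : Fin n → ℤ) (z : CechTotal (n := n) k (IdealQuotient I J)) :
    takayamaCochain hJ a (cechD k (IdealQuotient I J) z) =
      relCoboundary k (degreeComplex J a) (degreeComplex I a) (takayamaCochain hJ a z) := by
  funext E
  by_cases hE : IsRelFace (degreeComplex J a) (degreeComplex I a) E
  · have hd : Disjoint E (negSupport a) := hE.1.1
    have hJE := ((isRelFace_iff hd).1 hE).1
    have hr : relCoboundary k (degreeComplex J a) (degreeComplex I a) (takayamaCochain hJ a z) E =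
        ∑ v ∈ E, (-1 : k) ^ position E v * takayamaCochain hJ a z (E.erase v) := if_pos hE
    have hterm : ∀ v, laurentCoeff hJ a ((-1 : ℤ) ^ position (negSupport a ∪ E) v •
        locMap k (IdealQuotient I J) ((negSupport a ∪ E).erase_subset v)
          (z ((negSupport a ∪ E).erase v))) =
        (-1 : k) ^ position (negSupport a ∪ E) v *
          laurentCoeff hJ a (z ((negSupport a ∪ E).erase v)) := by
      intro v
      rw [map_zsmul, laurentCoeff_locMap hJ _ hJE, zsmul_eq_mul]
      simp
    rw [hr, takayamaCochain_of_disjoint hJ _ hd, cechD_apply, map_sum,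
      Finset.sum_congr rfl fun v _ => hterm v, Finset.sum_union hd.symm,
      -- The terms with `v ∈ G_a` do not contribute: there `x_v` is not inverted.
      Finset.sum_eq_zero (s := negSupport a), zero_add, Finset.mul_sum]
    · refine Finset.sum_congr rfl fun v hv => ?_
      have hvG : v ∉ negSupport a := Finset.disjoint_left.1 hd hv
      have he : (negSupport a ∪ E).erase v = negSupport a ∪ E.erase v := by
        rw [Finset.erase_union_distrib, Finset.erase_eq_of_notMem hvG]
      rw [takayamaCochain_of_disjoint hJ _
        (Finset.disjoint_of_subset_left (E.erase_subset v) hd), he, position_union hd,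
        crossings_erase _ hv, pow_add, pow_add]
      linear_combination ((-1 : k) ^ crossings (negSupport a) (E.erase v) *
        (-1 : k) ^ position E v * laurentCoeff hJ a (z (negSupport a ∪ E.erase v))) *
        neg_one_pow_mul_self (k := k) (position (negSupport a) v)
    · intro v hv
      rw [laurentCoeff_eq_zero hI hJ (laurentNotMem_of_not_subset fun hc =>
        Finset.notMem_erase v _ (hc hv)), mul_zero]
  · have h0 : takayamaCochain hJ a (cechD k (IdealQuotient I J) z) E = 0 := by
      by_contra h0
      exact hE (isRelFace_of_takayamaCochain_ne_zero hI hJ h0)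
    rw [h0]
    exact (if_neg hE).symm

/-- The homogeneous Čech cochain of degree `a` which corresponds to a relative cochain `φ`. The
component at `F` is zero where the class of `x^a` is not defined; by `eq_of_mem_laurentClass` the
choice of a representative of that class does not matter. -/
def homogeneousCochain (I J : Ideal (MvPolynomial (Fin n) k)) (a : Fin n → ℤ)
    (φ : Finset (Fin n) → k) : CechTotal (n := n) k (IdealQuotient I J) := by
  classical
  exact fun F => if h : (laurentClass I J F a).Nonempty then
    ((-1 : k) ^ crossings (negSupport a) (F \ negSupport a) * φ (F \ negSupport a)) • h.some
    else 0

theorem homogeneousCochain_mem_locPiece (a : Fin n → ℤ) (φ : Finset (Fin n) → k)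
    (F : Finset (Fin n)) : homogeneousCochain I J a φ F ∈ locPiece I J F a := by
  unfold homogeneousCochain
  split_ifs with h
  · exact Submodule.smul_mem _ _ (Submodule.subset_span h.some_mem)
  · exact zero_mem _

theorem negSupport_subset_of_nonempty {F : Finset (Fin n)} {a : Fin n → ℤ}
    (h : (laurentClass I J F a).Nonempty) : negSupport a ⊆ F := by
  obtain ⟨u, c, d, hc, hd, hcd, -⟩ := h
  by_contra hF
  exact laurentNotMem_of_not_subset (K := I) hF c d hd hcd hc

theorem takayamaCochain_homogeneousCochain (hI : IsMonomialIdeal I) (hJ : IsMonomialIdeal J)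
    {a : Fin n → ℤ} {j : ℤ} {φ : Finset (Fin n) → k}
    (hφ : φ ∈ relCochains k (degreeComplex J a) (degreeComplex I a) j) :
    takayamaCochain hJ a (homogeneousCochain I J a φ) = φ := by
  funext E
  by_cases hE : IsRelFace (degreeComplex J a) (degreeComplex I a) E
  · have hd : Disjoint E (negSupport a) := hE.1.1
    obtain ⟨h1, h2⟩ := (isRelFace_iff hd).1 hE
    have h3 := (laurentNotMem_or_nonempty I J (negSupport a ∪ E) a).resolve_left h2
    rw [takayamaCochain_of_disjoint hJ _ hd, homogeneousCochain, dif_pos h3, map_smul,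
      laurentCoeff_of_mem_laurentClass hJ h1 h3.some_mem, Finset.union_sdiff_cancel_left hd.symm,
      smul_eq_mul, mul_one, ← mul_assoc, neg_one_pow_mul_self, one_mul]
  · have h0 : takayamaCochain hJ a (homogeneousCochain I J a φ) E = 0 := by
      by_contra h0
      exact hE (isRelFace_of_takayamaCochain_ne_zero hI hJ h0)
    rw [h0]
    by_contra h1
    exact hE (hφ E (Ne.symm h1)).1

theorem homogeneousCochain_mem {a : Fin n → ℤ} {i : ℕ} {j : ℤ}
    (hj : j = i - ((negSupport a).card : ℤ) - 1) {φ : Finset (Fin n) → k}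
    (hφ : φ ∈ relCochains k (degreeComplex J a) (degreeComplex I a) j) :
    homogeneousCochain I J a φ ∈ cechCochains k (IdealQuotient I J) i := by
  intro F hF
  unfold homogeneousCochain
  split_ifs with h
  · have hG := negSupport_subset_of_nonempty h
    have h0 : φ (F \ negSupport a) = 0 := by
      by_contra h0
      have h1 := (hφ _ h0).2
      have h2 := Finset.card_sdiff_add_card_eq_card hG
      omega
    rw [h0, mul_zero, zero_smul]
  · rfl

theorem cechD_mem_locPiece {a : Fin n → ℤ} {z : CechTotal (n := n) k (IdealQuotient I J)}
    (hz : ∀ F, z F ∈ locPiece I J F a) (F : Finset (Fin n)) :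
    cechD k (IdealQuotient I J) z F ∈ locPiece I J F a := by
  rw [cechD_apply]
  exact sum_mem fun v _ => zsmul_mem (locMap_mem_locPiece _ (hz _)) _

/-- A homogeneous Čech cochain of degree `a` is determined by the corresponding relative
cochain. -/
theorem eq_zero_of_takayamaCochain (hI : IsMonomialIdeal I) (hJ : IsMonomialIdeal J)
    {a : Fin n → ℤ} {z : CechTotal (n := n) k (IdealQuotient I J)}
    (hz : ∀ F, z F ∈ locPiece I J F a) (h : takayamaCochain hJ a z = 0) : z = 0 := by
  funext F
  refine eq_zero_of_laurentCoeff hJ (hz F) ?_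
  by_cases hF : negSupport a ⊆ F
  · have h1 := congrFun h (F \ negSupport a)
    rw [takayamaCochain_of_disjoint hJ _ Finset.sdiff_disjoint,
      Finset.union_sdiff_of_subset hF] at h1
    exact (mul_eq_zero.1 h1).resolve_left (pow_ne_zero _ (neg_ne_zero.2 one_ne_zero))
  · exact laurentCoeff_eq_zero hI hJ (laurentNotMem_of_not_subset hF) _

theorem corresponds_takayamaCochain (hJ : IsMonomialIdeal J) {a : Fin n → ℤ}
    {z : CechTotal (n := n) k (IdealQuotient I J)} (hz : ∀ F, z F ∈ locPiece I J F a) :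
    Corresponds I J a z (takayamaCochain hJ a z) := by
  intro E hE u hu
  rw [takayamaCochain_of_disjoint hJ _ hE, ← mul_assoc, neg_one_pow_mul_self, one_mul]
  exact eq_laurentCoeff_smul hJ hu (hz _)

/-- Multiplication by `x^b` corresponds to restriction of cochains. -/
theorem takayamaCochain_monomial_smul (hI : IsMonomialIdeal I) (hJ : IsMonomialIdeal J)
    {a : Fin n → ℤ} {b : Fin n →₀ ℕ} (hG : negSupport (addDegree a b) = negSupport a)
    (z : CechTotal (n := n) k (IdealQuotient I J)) :
    takayamaCochain hJ (addDegree a b) (monomial b (1 : k) • z) =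
      restrictFun k (degreeComplex J (addDegree a b)) (degreeComplex I (addDegree a b))
        (takayamaCochain hJ a z) := by
  funext E
  by_cases hE : IsRelFace (degreeComplex J (addDegree a b)) (degreeComplex I (addDegree a b)) E
  · have hr : restrictFun k (degreeComplex J (addDegree a b)) (degreeComplex I (addDegree a b))
        (takayamaCochain hJ a z) E = takayamaCochain hJ a z E := if_pos hE
    have hd' : Disjoint E (negSupport (addDegree a b)) := hE.1.1
    have hd : Disjoint E (negSupport a) := hG ▸ hd'
    have h1 := ((isRelFace_iff hd').1 hE).1
    have h2 := (mem_degreeComplex_iff J a hd).1 (degreeComplex_addDegree_le J hG hE.1)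
    rw [hr, takayamaCochain_of_disjoint hJ _ hd, takayamaCochain_of_disjoint hJ _ hd']
    rw [hG] at h1 ⊢
    rw [Pi.smul_apply, laurentCoeff_monomial_smul hJ b h2 h1]
  · have h0 : takayamaCochain hJ (addDegree a b) (monomial b (1 : k) • z) E = 0 := by
      by_contra h0
      exact hE (isRelFace_of_takayamaCochain_ne_zero hI hJ h0)
    rw [h0]
    exact (if_neg hE).symm

/-! ### The isomorphism on cohomology -/

def takayamaCocycle (hI : IsMonomialIdeal I) (hJ : IsMonomialIdeal J) (a : Fin n → ℤ) (i : ℕ)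
    {j : ℤ} (hj : j = i - ((negSupport a).card : ℤ) - 1) :
    ↥(cechCocycles (n := n) k (IdealQuotient I J) i) →ₗ[k]
      ↥(relCocycles k (degreeComplex J a) (degreeComplex I a) j) where
  toFun z := ⟨takayamaCochain hJ a z.1, takayamaCochain_mem hI hJ z.2.1 hj, by
    have h0 : cechD k (IdealQuotient I J) z.1 = 0 := z.2.2
    change relCoboundary k (degreeComplex J a) (degreeComplex I a) (takayamaCochain hJ a z.1) = 0
    rw [← takayamaCochain_cechD hI hJ, h0, map_zero]⟩
  map_add' z w := Subtype.ext (map_add (takayamaCochain hJ a) z.1 w.1)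
  map_smul' r z := Subtype.ext (map_smul (takayamaCochain hJ a) r z.1)

theorem takayamaCochain_mem_relCoboundaries (hI : IsMonomialIdeal I) (hJ : IsMonomialIdeal J)
    (a : Fin n → ℤ) {i : ℕ} {j : ℤ} (hj : j = i - ((negSupport a).card : ℤ) - 1)
    {z : CechTotal (n := n) k (IdealQuotient I J)}
    (hz : z ∈ cechCoboundaries k (IdealQuotient I J) i) :
    takayamaCochain hJ a z ∈
      relCoboundaries k (degreeComplex J a) (degreeComplex I a) j := by
  cases i with
  | zero =>
    have h0 : z = 0 := hz
    rw [h0, map_zero]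
    exact zero_mem _
  | succ i =>
    obtain ⟨w, hw, rfl⟩ := hz
    exact ⟨takayamaCochain hJ a w, takayamaCochain_mem hI hJ hw (by push_cast at hj; omega),
      (takayamaCochain_cechD hI hJ a w).symm⟩

/-- The comparison map on cohomology, defined on all of `Hⁱ_𝔪(I / J)`. -/
def takayamaMap (hI : IsMonomialIdeal I) (hJ : IsMonomialIdeal J) (a : Fin n → ℤ) (i : ℕ)
    {j : ℤ} (hj : j = i - ((negSupport a).card : ℤ) - 1) :
    LocalCohomology (n := n) k (IdealQuotient I J) i →ₗ[k]
      RelCohomology k (degreeComplex J a) (degreeComplex I a) j :=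
  Submodule.mapQ (((cechCoboundaries (n := n) k (IdealQuotient I J) i).submoduleOf
      (cechCocycles (n := n) k (IdealQuotient I J) i)).restrictScalars k) _
    (takayamaCocycle hI hJ a i hj)
    (fun _ hz => takayamaCochain_mem_relCoboundaries hI hJ a hj hz) ∘ₗ
  (Submodule.Quotient.restrictScalarsEquiv k _).symm.toLinearMap

/-- A homogeneous cocycle whose relative cocycle is a coboundary is itself a coboundary. -/
theorem mem_cechCoboundaries_of_takayamaCochain (hI : IsMonomialIdeal I)
    (hJ : IsMonomialIdeal J) {a : Fin n → ℤ} {i : ℕ} {j : ℤ}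
    (hj : j = i - ((negSupport a).card : ℤ) - 1)
    {z : CechTotal (n := n) k (IdealQuotient I J)} (hz : ∀ F, z F ∈ locPiece I J F a)
    (h : takayamaCochain hJ a z ∈ relCoboundaries k (degreeComplex J a) (degreeComplex I a) j) :
    z ∈ cechCoboundaries k (IdealQuotient I J) i := by
  obtain ⟨ψ, hψ, hψz⟩ := h
  cases i with
  | zero =>
    -- There are no faces with fewer than zero vertices.
    have h0 : ψ = 0 := by
      funext E
      by_contra h0
      have h1 := (hψ E h0).2
      push_cast at hj
      omega
    rw [h0, map_zero] at hψz
    rw [eq_zero_of_takayamaCochain hI hJ hz hψz.symm]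
    exact zero_mem _
  | succ i =>
    have hψ' := homogeneousCochain_mem (i := i) (by push_cast at hj; omega) hψ
    refine ⟨homogeneousCochain I J a ψ, hψ', sub_eq_zero.1 ?_⟩
    refine eq_zero_of_takayamaCochain (a := a) hI hJ (fun F => sub_mem
      (cechD_mem_locPiece (homogeneousCochain_mem_locPiece a ψ) F) (hz F)) ?_
    rw [map_sub, takayamaCochain_cechD hI hJ, takayamaCochain_homogeneousCochain hI hJ hψ, hψz,
      sub_self]

theorem takayamaMap_bijective (hI : IsMonomialIdeal I) (hJ : IsMonomialIdeal J)
    (a : Fin n → ℤ) (i : ℕ) {j : ℤ} (hj : j = i - ((negSupport a).card : ℤ) - 1) :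
    Function.Bijective ((takayamaMap hI hJ a i hj).domRestrict (cohomologyPiece I J i a)) := by
  constructor
  · rw [injective_iff_map_eq_zero]
    rintro ⟨_, z, hz, rfl⟩ h
    have h0 : takayamaCocycle hI hJ a i hj z ∈
        (relCoboundaries k (degreeComplex J a) (degreeComplex I a) j).submoduleOf _ :=
      (Submodule.Quotient.mk_eq_zero _).1 h
    exact Subtype.ext ((Submodule.Quotient.mk_eq_zero _).2
      (mem_cechCoboundaries_of_takayamaCochain hI hJ hj hz h0))
  · intro y
    obtain ⟨φ, rfl⟩ := Submodule.Quotient.mk_surjective _ y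
    have hφ0 : relCoboundary k (degreeComplex J a) (degreeComplex I a) φ.1 = 0 := φ.2.2
    have hφz := takayamaCochain_homogeneousCochain hI hJ φ.2.1
    have hz : ∀ F, homogeneousCochain I J a φ.1 F ∈ locPiece I J F a :=
      homogeneousCochain_mem_locPiece a φ.1
    have hd : cechD k (IdealQuotient I J) (homogeneousCochain I J a φ.1) = 0 :=
      eq_zero_of_takayamaCochain hI hJ (cechD_mem_locPiece hz)
        (by rw [takayamaCochain_cechD hI hJ, hφz, hφ0])
    let z : ↥(cechCocycles (n := n) k (IdealQuotient I J) i) :=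
      ⟨homogeneousCochain I J a φ.1, homogeneousCochain_mem hj φ.2.1, hd⟩
    refine ⟨⟨cechClass k (IdealQuotient I J) i z, z, hz, rfl⟩, ?_⟩
    exact congrArg Submodule.Quotient.mk (Subtype.ext hφz)

/-- The relative Hochster-Takayama isomorphism. -/
def takayamaEquiv (hI : IsMonomialIdeal I) (hJ : IsMonomialIdeal J) (a : Fin n → ℤ) (i : ℕ)
    {j : ℤ} (hj : j = i - ((negSupport a).card : ℤ) - 1) :
    ↥(cohomologyPiece I J i a) ≃ₗ[k]
      RelCohomology k (degreeComplex J a) (degreeComplex I a) j :=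
  LinearEquiv.ofBijective _ (takayamaMap_bijective hI hJ a i hj)

theorem isHochsterTakayama_takayamaEquiv (hI : IsMonomialIdeal I) (hJ : IsMonomialIdeal J)
    (a : Fin n → ℤ) (i : ℕ) {j : ℤ} (hj : j = i - ((negSupport a).card : ℤ) - 1) :
    IsHochsterTakayama I J i a j (takayamaEquiv hI hJ a i hj) :=
  fun z hz => ⟨takayamaCocycle hI hJ a i hj z, corresponds_takayamaCochain hJ hz, rfl⟩

theorem takayamaEquiv_mulMonomial (hI : IsMonomialIdeal I) (hJ : IsMonomialIdeal J)
    {a : Fin n → ℤ} {b : Fin n →₀ ℕ} (hG : negSupport (addDegree a b) = negSupport a) (i : ℕ)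
    {j : ℤ} (hj : j = i - ((negSupport a).card : ℤ) - 1)
    (hj' : j = i - ((negSupport (addDegree a b)).card : ℤ) - 1)
    (h : ↥(cohomologyPiece I J i a)) :
    takayamaEquiv hI hJ (addDegree a b) i hj' (mulMonomial I J i a b h) =
      relRestriction k (degreeComplex_addDegree_le J hG) (degreeComplex_addDegree_le I hG) j
        (takayamaEquiv hI hJ a i hj h) := by
  obtain ⟨_, z, hz, rfl⟩ := h
  exact congrArg Submodule.Quotient.mk
    (Subtype.ext (takayamaCochain_monomial_smul hI hJ hG z.1))

end Comparison

theorem eq_zero_iff_of_comm {R M N M' N' : Type*} [Semiring R] [AddCommMonoid M]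
    [AddCommMonoid N] [AddCommMonoid M'] [AddCommMonoid N'] [Module R M] [Module R N]
    [Module R M'] [Module R N'] (e : M ≃ₗ[R] N) (e' : M' ≃ₗ[R] N') {f : M →ₗ[R] M'}
    {g : N →ₗ[R] N'} (h : ∀ x, e' (f x) = g (e x)) : f = 0 ↔ g = 0 := by
  constructor
  · rintro rfl
    ext y
    obtain ⟨x, rfl⟩ := e.surjective y
    rw [← h]
    simp
  · rintro rfl
    ext x
    exact e'.injective (by simpa using h x)

end RelativeTakayama

end

open RelativeTakayama in
theorem theorem3p7 {n : ℕ} {k : Type*} [Field k] (I J : Ideal (MvPolynomial (Fin n) k))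
    (hI : IsMonomialIdeal I) (hJ : IsMonomialIdeal J) (hJI : J ≤ I) (i : ℕ)
    (a : Fin n → ℤ) (b : Fin n →₀ ℕ)
    (hG : negSupport (addDegree a b) = negSupport a) :
    ∃ (Θ : ↥(cohomologyPiece I J i a) ≃ₗ[k]
          RelCohomology k (degreeComplex J a) (degreeComplex I a)
            ((i : ℤ) - ((negSupport a).card : ℤ) - 1))
      (Θ' : ↥(cohomologyPiece I J i (addDegree a b)) ≃ₗ[k]
          RelCohomology k (degreeComplex J (addDegree a b)) (degreeComplex I (addDegree a b))
            ((i : ℤ) - ((negSupport a).card : ℤ) - 1)),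
      IsHochsterTakayama I J i a _ Θ ∧
      IsHochsterTakayama I J i (addDegree a b) _ Θ' ∧
      (∀ h : ↥(cohomologyPiece I J i a),
        Θ' (mulMonomial I J i a b h) =
          relRestriction k (degreeComplex_addDegree_le J hG) (degreeComplex_addDegree_le I hG) _
            (Θ h)) ∧
      (mulMonomial I J i a b = 0 ↔
        relRestriction k (degreeComplex_addDegree_le J hG) (degreeComplex_addDegree_le I hG)
          ((i : ℤ) - ((negSupport a).card : ℤ) - 1) = 0) := by

  have hj' : (i : ℤ) - ((negSupport a).card : ℤ) - 1 =
      i - ((negSupport (addDegree a b)).card : ℤ) - 1 := by rw [hG]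
  have hcomm := takayamaEquiv_mulMonomial hI hJ hG i rfl hj'
  exact ⟨takayamaEquiv hI hJ a i rfl, takayamaEquiv hI hJ (addDegree a b) i hj',
    isHochsterTakayama_takayamaEquiv hI hJ a i rfl,
    isHochsterTakayama_takayamaEquiv hI hJ (addDegree a b) i hj', hcomm,
    eq_zero_iff_of_comm _ _ hcomm⟩
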